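/- Conventions. $S_{0,n}$ is the sphere with $n$ points removed. A curve is a homotopy class of unoriented essential simple closed curves (bounding neither a disk nor a once-punctured disk), $i(\cdot,\cdot)$ is the geometric intersection number, and a multicurve is a set of distinct, pairwise disjoint ($i=0$) curves. A multicurve $Q$ on $S_{0,m}$ has deficiency $m-3-|Q|$; a pants decomposition is a maximal multicurve. The pants graph $\mathcal P(S_{0,m})$ has the pants decompositions as vertices, two of them being adjacent if they have the form $\{\alpha\}\cup Q$, $\{\alpha'\}\cup Q$ with $Q$ a deficiency-$1$ multicurve and $i(\alpha,\alpha')=2$. For a multicurve $Q$, $(S_{0,m}-Q)_0$ is the union of the components of $S_{0,m}-Q$ that are not thrice-punctured spheres. $\mathrm{Mod}(S_{0,n})$ is the group of isotopy classes of orientation-preserving homeomorphisms; it acts on $\mathcal P(S_{0,n})$. Let $n\ge 5$ and let $\mathcal X\subset\mathcal P(S_{0,n})$ be a subgraph. Consider pairs $(f,Q)$ of a $\pi_1$-injective embedding $f:S_{0,n}\to S_{0,m}$ and a deficiency-$(n-3)$ multicurve $Q$ on $S_{0,m}$ with $f(S_{0,n})=(S_{0,m}-Q)_0$, and put $f^Q(u)=f(u)\cup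 Q$ for vertices $u$ of $\mathcal P(S_{0,n})$. The embedding $f$ induces a map $\phi:\mathcal X\to\mathcal P(S_{0,m})$ if for some such $Q$ one has $f^Q(u)=\phi(u)$ for all vertices $u$ of $\mathcal X$. The subgraph $\mathcal X$ is rigid if for every punctured sphere $S_{0,m}$ every injective simplicial map $\phi:\mathcal X\to\mathcal P(S_{0,m})$ is induced by some $\pi_1$-injective embedding $f:S_{0,n}\to S_{0,m}$, whose isotopy class is unique. It is weakly rigid if, for all $m$ and all such pairs $(f_1,Q_1)$, $(f_2,Q_2)$ on the same $S_{0,m}$, the equality $f_1^{Q_1}|_{\mathcal X}=f_2^{Q_2}|_{\mathcal X}$ implies $Q_1=Q_2$ and that $f_1$, $f_2$ are isotopic. A half twist $T_\alpha^{1/2}$ about a curve $\alpha$ is a mapping class whose square is the Dehn twist about $\alpha$, and $T_\alpha^{-1/2}$ is its inverse. Proposition. Let $n\ge5$ and let $\mathcal X\subset\mathcal P(S_{0,n})$ be a finite rigid subgraph with $\mathrm{Mod}(S_{0,n})\cdot\mathcal X=\mathcal P(S_{0,n})$. Suppose that there are a finite set $C$ of curves on $S_{0,n}$ and, for each $\alpha\in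 C$, a half twist $T_\alpha^{1/2}$ about $\alpha$, such that (1) $\{T_\alpha^{\pm1/2}\mid\alpha\in C\}$ generates $\mathrm{Mod}(S_{0,n})$; (2) $\mathcal X\cap T_\alpha^{i}(\mathcal X)$ is weakly rigid for all $\alpha\in C$ and $i\in\{-\tfrac12,\tfrac12\}$. Then the sequence $\mathcal X_1=\mathcal X$, $\mathcal X_{k+1}=\mathcal X_k\cup\bigcup_{\alpha\in C}\bigl(T_\alpha^{1/2}(\mathcal X_k)\cup T_\alpha^{-1/2}(\mathcal X_k)\bigr)$ satisfies $\mathcal X_1\subset\mathcal X_2\subset\cdots$, each $\mathcal X_k$ is a finite rigid subgraph, and $\bigcup_{k\ge1}\mathcal X_k=\mathcal P(S_{0,n})$. -/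

import Mathlib

open Topology unitInterval

noncomputable section

namespace PantsRigidity

/-! ### Punctured spheres -/

/-- The unit sphere in Euclidean three-space. -/
abbrev Sphere2 : Type := Metric.sphere (0 : EuclideanSpace ℝ (Fin 3)) 1

/-- The sphere punctured at the finite set `P`; it is a model of `S_{0,n}` for `n = P.card`. -/
abbrev PuncturedSphere (P : Finset Sphere2) : Type := {x : Sphere2 // x ∉ P}

section General

variable {X Y Z : Type} [TopologicalSpace X] [TopologicalSpace Y] [TopologicalSpace Z]

/-! ### Simple closed curves, essential curves, intersection numbers -/

/-- A parametrized simple closed curve. -/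
def SimpleClosedCurve (X : Type) [TopologicalSpace X] : Type :=
  {c : C(Circle, X) // Function.Injective c}

/-- The underlying subset of a simple closed curve. -/
def SimpleClosedCurve.image (c : SimpleClosedCurve X) : Set X := Set.range c.1

/-- Two simple closed curves are equivalent if they are freely homotopic after a
reparametrization of the circle (possibly reversing its direction). -/
instance curveSetoid (X : Type) [TopologicalSpace X] : Setoid (SimpleClosedCurve X) where
  r c d := ∃ r : Circle ≃ₜ Circle, c.1.Homotopic (d.1.comp (r : C(Circle, Circle)))
  iseqv :=
    { refl := fun c => ⟨Homeomorph.refl _, ContinuousMap.Homotopic.refl _⟩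
      symm := by
        rintro c d ⟨r, h⟩
        refine ⟨r.symm, ?_⟩
        have h2 := (h.comp (ContinuousMap.Homotopic.refl (r.symm : C(Circle, Circle)))).symm
        convert h2 using 1
        ext z
        simp
      trans := by
        rintro c d e ⟨r, h⟩ ⟨s, k⟩
        refine ⟨r.trans s, h.trans ?_⟩
        exact k.comp (ContinuousMap.Homotopic.refl (r : C(Circle, Circle))) }

/-- Homotopy classes of (unoriented) simple closed curves, essential or not. -/
def CurveClass (X : Type) [TopologicalSpace X] : Type := Quotient (curveSetoid X)

/-- The homotopy class of a simple closed curve. -/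
def CurveClass.mk (c : SimpleClosedCurve X) : CurveClass X := Quotient.mk (curveSetoid X) c

/-- The curve is the boundary of an embedded closed disk. -/
def SimpleClosedCurve.BoundsDisk (c : SimpleClosedCurve X) : Prop :=
  ∃ e : {z : ℂ // ‖z‖ ≤ 1} → X, IsEmbedding e ∧ e '' {z | ‖z.1‖ = 1} = c.image

/-- The curve is the boundary of a once-punctured disk. The embedding of the punctured closed
disk is required to have closed image, so that the missing centre is a puncture of `X`. -/
def SimpleClosedCurve.BoundsPuncturedDisk (c : SimpleClosedCurve X) : Prop :=
  ∃ e : {z : ℂ // z ≠ 0 ∧ ‖z‖ ≤ 1} → X, IsClosedEmbedding e ∧ e '' {z | ‖z.1‖ = 1} = c.image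

/-- A simple closed curve is essential if it bounds neither a disk nor a once-punctured disk. -/
def SimpleClosedCurve.IsEssential (c : SimpleClosedCurve X) : Prop :=
  ¬ c.BoundsDisk ∧ ¬ c.BoundsPuncturedDisk

/-- The class of an essential simple closed curve: these classes are the "curves" on `X`. -/
def CurveClass.IsEssential (α : CurveClass X) : Prop :=
  ∃ c : SimpleClosedCurve X, CurveClass.mk c = α ∧ c.IsEssential

/-- The geometric intersection number: the minimal number of intersection points of
representatives. (Removing an isolated point of tangency never increases the number of
intersection points, so this is also the minimum over transverse representatives.) -/
def CurveClass.inter (α β : CurveClass X) : ℕ∞ :=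
  ⨅ (c : SimpleClosedCurve X) (d : SimpleClosedCurve X)
    (_ : CurveClass.mk c = α) (_ : CurveClass.mk d = β), (c.image ∩ d.image).encard

/-- A multicurve: a set of pairwise distinct, pairwise disjoint (classes of essential) curves. -/
def IsMulticurve (Q : Set (CurveClass X)) : Prop :=
  (∀ α ∈ Q, α.IsEssential) ∧ Q.Pairwise fun α β => α.inter β = 0

/-- A pants decomposition is a maximal multicurve. -/
def IsPantsDecomposition (u : Set (CurveClass X)) : Prop := Maximal IsMulticurve u

/-! ### Push-forward of curves -/

/-- The image of a simple closed curve under an injective continuous map. -/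
def SimpleClosedCurve.map (f : C(X, Y)) (hf : Function.Injective f) (c : SimpleClosedCurve X) :
    SimpleClosedCurve Y :=
  ⟨f.comp c.1, hf.comp c.2⟩

/-- The action of an injective continuous map on homotopy classes of simple closed curves. -/
def CurveClass.map (f : C(X, Y)) (hf : Function.Injective f) : CurveClass X → CurveClass Y :=
  Quotient.map (SimpleClosedCurve.map f hf) (by
    rintro c d ⟨r, h⟩
    exact ⟨r, (ContinuousMap.Homotopic.refl f).comp h⟩)

theorem CurveClass.map_mk (f : C(X, Y)) (hf : Function.Injective f) (c : SimpleClosedCurve X) :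
    CurveClass.map f hf (CurveClass.mk c) = CurveClass.mk (c.map f hf) := rfl

theorem CurveClass.map_congr_of_homotopic {f g : C(X, Y)} (hf : Function.Injective f)
    (hg : Function.Injective g) (h : f.Homotopic g) (α : CurveClass X) :
    CurveClass.map f hf α = CurveClass.map g hg α := by
  induction α using Quotient.inductionOn with
  | h c =>
    refine Quotient.sound ⟨Homeomorph.refl _, ?_⟩
    exact h.comp (ContinuousMap.Homotopic.refl c.1)

theorem SimpleClosedCurve.image_map (f : C(X, Y)) (hf : Function.Injective f)
    (c : SimpleClosedCurve X) : (c.map f hf).image = f '' c.image := by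
  simp [SimpleClosedCurve.image, SimpleClosedCurve.map, Set.range_comp]

/-! ### Homeomorphisms acting on curves -/

/-- The permutation of the curve classes given by a homeomorphism. -/
def homeoPerm (X : Type) [TopologicalSpace X] : (X ≃ₜ X) →* Equiv.Perm (CurveClass X) where
  toFun h :=
    { toFun := CurveClass.map (h : C(X, X)) h.injective
      invFun := CurveClass.map (h.symm : C(X, X)) h.symm.injective
      left_inv := by
        intro α
        induction α using Quotient.inductionOn with
        | h c =>
          refine congrArg (Quotient.mk (curveSetoid X)) (Subtype.ext ?_)
          ext z
          exact h.symm_apply_apply _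
      right_inv := by
        intro α
        induction α using Quotient.inductionOn with
        | h c =>
          refine congrArg (Quotient.mk (curveSetoid X)) (Subtype.ext ?_)
          ext z
          exact h.apply_symm_apply _ }
  map_one' := by
    ext α
    induction α using Quotient.inductionOn with
    | h c => rfl
  map_mul' h k := by
    ext α
    induction α using Quotient.inductionOn with
    | h c => rfl

theorem homeoPerm_mk (h : X ≃ₜ X) (c : SimpleClosedCurve X) :
    homeoPerm X h (CurveClass.mk c) = CurveClass.mk (c.map (h : C(X, X)) h.injective) := rfl

theorem isEssential_homeo (h : X ≃ₜ X) {α : CurveClass X} (hα : α.IsEssential) :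
    (homeoPerm X h α).IsEssential := by
  obtain ⟨c, rfl, hd, hp⟩ := hα
  refine ⟨_, rfl, ?_, ?_⟩
  · rintro ⟨e, he, hi⟩
    refine hd ⟨h.symm ∘ e, h.symm.isEmbedding.comp he, ?_⟩
    rw [Set.image_comp, hi]
    rw [SimpleClosedCurve.image_map, ← Set.image_comp]
    simp
  · rintro ⟨e, he, hi⟩
    refine hp ⟨h.symm ∘ e, h.symm.isClosedEmbedding.comp he, ?_⟩
    rw [Set.image_comp, hi]
    rw [SimpleClosedCurve.image_map, ← Set.image_comp]
    simp

theorem inter_homeo_le (h : X ≃ₜ X) (α β : CurveClass X) :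
    (homeoPerm X h α).inter (homeoPerm X h β) ≤ α.inter β := by
  refine le_iInf fun c => le_iInf fun d => le_iInf fun hc => le_iInf fun hd => ?_
  subst hc hd
  refine (iInf_le_of_le (c.map (h : C(X, X)) h.injective) <|
    iInf_le_of_le (d.map (h : C(X, X)) h.injective) <|
    iInf_le_of_le rfl <| iInf_le_of_le rfl le_rfl).trans ?_
  rw [SimpleClosedCurve.image_map, SimpleClosedCurve.image_map,
    ← Set.image_inter (f := (h : C(X, X))) h.injective]
  exact Set.encard_image_le _ _

theorem CurveClass.inter_comm (α β : CurveClass X) : α.inter β = β.inter α := by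
  have key : ∀ α β : CurveClass X, α.inter β ≤ β.inter α := by
    intro α β
    refine le_iInf fun c => le_iInf fun d => le_iInf fun hc => le_iInf fun hd => ?_
    rw [Set.inter_comm]
    exact iInf_le_of_le d <| iInf_le_of_le c <| iInf_le_of_le hd <| iInf_le_of_le hc le_rfl
  exact le_antisymm (key _ _) (key _ _)

/-! ### Mapping class groups -/

/-- The homeomorphisms that are isotopic to the identity, that is, joined to the identity by a
continuous path of homeomorphisms. -/
def homeoZero (X : Type) [TopologicalSpace X] : Subgroup (X ≃ₜ X) where
  carrier := {h | ∃ H : C(I × X, X), (∀ t, IsHomeomorph fun x => H (t, x)) ∧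
    (∀ x, H (0, x) = x) ∧ ∀ x, H (1, x) = h x}
  one_mem' := ⟨⟨Prod.snd, continuous_snd⟩, fun _ => (Homeomorph.refl X).isHomeomorph,
    fun _ => rfl, fun _ => rfl⟩
  mul_mem' := by
    rintro a b ⟨H, hH, h0, h1⟩ ⟨K, hK, k0, k1⟩
    refine ⟨⟨fun p => H (p.1, K p), by fun_prop⟩, fun t => (hH t).comp (hK t), ?_, ?_⟩
    · intro x
      simp [h0, k0]
    · intro x
      simp [h1, k1]
  inv_mem' := by
    rintro a ⟨H, hH, h0, h1⟩
    refine ⟨⟨fun p => H (σ p.1, a.symm p.2), by fun_prop⟩,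
      fun t => (hH (σ t)).comp a.symm.isHomeomorph, ?_, ?_⟩
    · intro x
      simp [h1]
    · intro x
      simp [h0]

instance homeoZero_normal (X : Type) [TopologicalSpace X] : (homeoZero X).Normal where
  conj_mem := by
    rintro a ⟨H, hH, h0, h1⟩ g
    refine ⟨⟨fun p => g (H (p.1, g.symm p.2)), by fun_prop⟩,
      fun t => g.isHomeomorph.comp ((hH t).comp g.symm.isHomeomorph), ?_, ?_⟩
    · intro x
      simp [h0]
    · intro x
      simp [h1]

/-- The extended mapping class group: homeomorphisms up to isotopy. -/
abbrev ExtMod (X : Type) [TopologicalSpace X] : Type := (X ≃ₜ X) ⧸ homeoZero X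

/-- The action of mapping classes on curve classes. -/
def modPerm (X : Type) [TopologicalSpace X] : ExtMod X →* Equiv.Perm (CurveClass X) :=
  QuotientGroup.lift (homeoZero X) (homeoPerm X) (by
    rintro h ⟨H, -, h0, h1⟩
    ext α
    have hom : ((Homeomorph.refl X : X ≃ₜ X) : C(X, X)).Homotopic (h : C(X, X)) :=
      ⟨{ toContinuousMap := H, map_zero_left := h0, map_one_left := h1 }⟩
    have := CurveClass.map_congr_of_homotopic (Homeomorph.refl X).injective h.injective hom α
    induction α using Quotient.inductionOn with
    | h c => exact this.symm)

theorem isEssential_mod (g : ExtMod X) {α : CurveClass X} (hα : α.IsEssential) :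
    (modPerm X g α).IsEssential := by
  induction g using QuotientGroup.induction_on with
  | H h => exact isEssential_homeo h hα

theorem inter_mod (g : ExtMod X) (α β : CurveClass X) :
    (modPerm X g α).inter (modPerm X g β) = α.inter β := by
  have key : ∀ (g : ExtMod X) (α β : CurveClass X),
      (modPerm X g α).inter (modPerm X g β) ≤ α.inter β := by
    intro g α β
    induction g using QuotientGroup.induction_on with
    | H h => exact inter_homeo_le h α β
  refine le_antisymm (key g α β) ?_
  have := key g⁻¹ (modPerm X g α) (modPerm X g β)
  simpa using this

/-- The action of a mapping class on sets of curve classes. -/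
def modImage (g : ExtMod X) (u : Set (CurveClass X)) : Set (CurveClass X) := modPerm X g '' u

theorem modImage_one (u : Set (CurveClass X)) : modImage 1 u = u := by
  simp [modImage]

theorem modImage_mul (g h : ExtMod X) (u : Set (CurveClass X)) :
    modImage (g * h) u = modImage g (modImage h u) := by
  simp [modImage, Set.image_image]

theorem isMulticurve_modImage (g : ExtMod X) {u : Set (CurveClass X)} (hu : IsMulticurve u) :
    IsMulticurve (modImage g u) := by
  refine ⟨?_, ?_⟩
  · rintro _ ⟨α, hα, rfl⟩
    exact isEssential_mod g (hu.1 α hα)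
  · rintro _ ⟨α, hα, rfl⟩ _ ⟨β, hβ, rfl⟩ hne
    rw [inter_mod]
    exact hu.2 hα hβ fun h => hne (by rw [h])

theorem isPantsDecomposition_modImage (g : ExtMod X) {u : Set (CurveClass X)}
    (hu : IsPantsDecomposition u) : IsPantsDecomposition (modImage g u) := by
  refine ⟨isMulticurve_modImage g hu.1, ?_⟩
  intro v hv huv
  have h1 : u ≤ modImage g⁻¹ v := by
    have : modImage g⁻¹ (modImage g u) ⊆ modImage g⁻¹ v := Set.image_mono huv
    rwa [← modImage_mul, inv_mul_cancel, modImage_one] at this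
  have h2 := hu.2 (isMulticurve_modImage g⁻¹ hv) h1
  have : modImage g (modImage g⁻¹ v) ⊆ modImage g u := Set.image_mono h2
  rwa [← modImage_mul, mul_inv_cancel, modImage_one] at this

/-! ### Dehn twists and half twists -/

/-- The mapping class `g` is the Dehn twist (of one of the two handednesses) about `α`: for some
embedded annulus `e` whose core represents `α`, it is represented by a homeomorphism that is the
standard twist map on the annulus and the identity outside it. -/
def IsDehnTwist (α : CurveClass X) (g : ExtMod X) : Prop :=
  ∃ (e : C(Circle × I, X)) (c : SimpleClosedCurve X) (h : X ≃ₜ X),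
    Function.Injective e ∧
    CurveClass.mk c = α ∧
    (∀ z : Circle, c.1 z = e (z, ⟨1 / 2, by norm_num, by norm_num⟩)) ∧
    (∀ (z : Circle) (t : I), h (e (z, t)) = e (z * Circle.exp (2 * Real.pi * t), t)) ∧
    (∀ x, x ∉ Set.range e → h x = x) ∧
    (QuotientGroup.mk h : ExtMod X) = g

/-- A half twist about `α` is a mapping class whose square is the Dehn twist about `α`. -/
def IsHalfTwist (α : CurveClass X) (g : ExtMod X) : Prop := IsDehnTwist α (g ^ 2)

/-! ### Embeddings, isotopies of embeddings, nontrivial pieces -/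

/-- A `π₁`-injective embedding. -/
structure PiOneEmbedding (X Y : Type) [TopologicalSpace X] [TopologicalSpace Y] where
  /-- The underlying continuous map. -/
  toMap : C(X, Y)
  isEmbedding : IsEmbedding toMap
  piOne_injective : ∀ x : X, Function.Injective (FundamentalGroup.map toMap x)

/-- The action of an embedding on sets of curve classes. -/
def PiOneEmbedding.image (f : PiOneEmbedding X Y) (u : Set (CurveClass X)) :
    Set (CurveClass Y) :=
  CurveClass.map f.toMap f.isEmbedding.injective '' u

/-- Isotopy of embeddings: they are joined by a continuous path of embeddings. -/
def PiOneEmbedding.Isotopic (f g : PiOneEmbedding X Y) : Prop :=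
  ∃ H : C(I × X, Y), (∀ t, IsEmbedding fun x => H (t, x)) ∧
    (∀ x, H (0, x) = f.toMap x) ∧ ∀ x, H (1, x) = g.toMap x

/-- `K` is the union of pairwise disjoint simple closed curves representing the elements
of `Q`. -/
def IsRealization (Q : Set (CurveClass X)) (K : Set X) : Prop :=
  ∃ r : Q → SimpleClosedCurve X, (∀ q, CurveClass.mk (r q) = q) ∧
    (∀ p q, p ≠ q → Disjoint (r p).image (r q).image) ∧ K = ⋃ q, (r q).image

/-- A pair of pants: a space homeomorphic to a thrice-punctured sphere. -/
def IsPairOfPants (W : Type) [TopologicalSpace W] : Prop :=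
  ∃ R : Finset Sphere2, R.card = 3 ∧ Nonempty (W ≃ₜ PuncturedSphere R)

/-- The nontrivial piece of the complement of `K`: the union of the components of the complement
that are not pairs of pants. -/
def nontrivialPiece (K : Set X) : Set X :=
  {x | x ∈ Kᶜ ∧ ¬ IsPairOfPants (connectedComponentIn Kᶜ x)}

end General

/-! ### Orientation-preserving mapping classes of punctured spheres -/

/-- The map induced on `H₂(S²; ℤ)` by a homeomorphism of the sphere. -/
def sphereH2 (F : Sphere2 ≃ₜ Sphere2) :
    ((AlgebraicTopology.singularHomologyFunctor (ModuleCat.{0} ℤ) 2).obj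
      (ModuleCat.of ℤ ℤ)).obj (TopCat.of Sphere2) ⟶
    ((AlgebraicTopology.singularHomologyFunctor (ModuleCat.{0} ℤ) 2).obj
      (ModuleCat.of ℤ ℤ)).obj (TopCat.of Sphere2) :=
  ((AlgebraicTopology.singularHomologyFunctor (ModuleCat.{0} ℤ) 2).obj
    (ModuleCat.of ℤ ℤ)).map (TopCat.ofHom (F : C(Sphere2, Sphere2)))

theorem sphereH2_one : sphereH2 1 = CategoryTheory.CategoryStruct.id _ :=
  CategoryTheory.Functor.map_id _ _

theorem sphereH2_mul (F G : Sphere2 ≃ₜ Sphere2) :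
    sphereH2 (F * G) = CategoryTheory.CategoryStruct.comp (sphereH2 G) (sphereH2 F) := by
  unfold sphereH2
  rw [← CategoryTheory.Functor.map_comp]
  rfl

/-- The orientation-preserving homeomorphisms of a punctured sphere: those whose extension to
the sphere acts trivially on `H₂(S²; ℤ)`. -/
def homeoPlus (P : Finset Sphere2) : Subgroup (PuncturedSphere P ≃ₜ PuncturedSphere P) where
  carrier := {h | ∃ F : Sphere2 ≃ₜ Sphere2, (∀ x : PuncturedSphere P, F x = h x) ∧
    sphereH2 F = CategoryTheory.CategoryStruct.id _}
  one_mem' := ⟨1, fun _ => rfl, sphereH2_one⟩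
  mul_mem' := by
    rintro a b ⟨F, hF, hF2⟩ ⟨G, hG, hG2⟩
    refine ⟨F * G, fun x => ?_, by rw [sphereH2_mul, hF2, hG2, CategoryTheory.Category.comp_id]⟩
    rw [Homeomorph.mul_apply, hG, hF]
    rfl
  inv_mem' := by
    rintro a ⟨F, hF, hF2⟩
    refine ⟨F⁻¹, fun x => ?_, ?_⟩
    · change F.symm x = (a.symm x : PuncturedSphere P)
      rw [Homeomorph.symm_apply_eq, hF]
      simp
    · have := sphereH2_mul F F⁻¹
      rw [mul_inv_cancel, sphereH2_one, hF2, CategoryTheory.Category.comp_id] at this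
      exact this.symm

/-- The mapping class group `Mod(S_{0,n})`, as a subgroup of the extended mapping class group. -/
def Mod (P : Finset Sphere2) : Subgroup (ExtMod (PuncturedSphere P)) :=
  (homeoPlus P).map (QuotientGroup.mk' (homeoZero (PuncturedSphere P)))

/-! ### The pants graph -/

/-- The vertices of the pants graph: the pants decompositions. -/
abbrev PantsDecomposition (P : Finset Sphere2) : Type :=
  {u : Set (CurveClass (PuncturedSphere P)) // IsPantsDecomposition u}

/-- Two pants decompositions differ by an elementary move. A multicurve `Q` has deficiency `1`
when `|Q| + 1 = n - 3`. -/
def ElementaryMove {P : Finset Sphere2} (u v : Set (CurveClass (PuncturedSphere P))) : Prop :=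
  ∃ (Q : Set (CurveClass (PuncturedSphere P))) (α β : CurveClass (PuncturedSphere P)),
    IsMulticurve Q ∧ Q.encard + 4 = P.card ∧ u = insert α Q ∧ v = insert β Q ∧ α.inter β = 2

/-- The pants graph of a punctured sphere. -/
def pantsGraph (P : Finset Sphere2) : SimpleGraph (PantsDecomposition P) where
  Adj u v := u ≠ v ∧ ElementaryMove u.1 v.1
  symm := ⟨by
    rintro u v ⟨hne, Q, α, β, hQ, hc, hu, hv, hi⟩
    exact ⟨hne.symm, Q, β, α, hQ, hc, hv, hu, by rw [CurveClass.inter_comm, hi]⟩⟩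
  loopless := ⟨fun _ h => h.1 rfl⟩

/-- The simplicial map of the pants graph induced by a mapping class. -/
def modHom {P : Finset Sphere2} (g : ExtMod (PuncturedSphere P)) :
    pantsGraph P →g pantsGraph P where
  toFun u := ⟨modImage g u.1, isPantsDecomposition_modImage g u.2⟩
  map_rel' := by
    rintro u v ⟨hne, Q, α, β, hQ, hc, hu, hv, hi⟩
    have inj : Function.Injective (modPerm (PuncturedSphere P) g) := Equiv.injective _
    refine ⟨fun h => hne (Subtype.ext (inj.image_injective (congrArg Subtype.val h))),
      modImage g Q, modPerm _ g α, modPerm _ g β, isMulticurve_modImage g hQ, ?_, ?_, ?_, ?_⟩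
    · rw [modImage, inj.encard_image, hc]
    · simp [modImage, hu, Set.image_insert_eq]
    · simp [modImage, hv, Set.image_insert_eq]
    · rw [inter_mod, hi]

/-- The translate `g · 𝒳` of a subgraph of the pants graph by a mapping class. -/
def translate {P : Finset Sphere2} (g : ExtMod (PuncturedSphere P))
    (𝒳 : (pantsGraph P).Subgraph) : (pantsGraph P).Subgraph :=
  𝒳.map (modHom g)

/-! ### Rigid and weakly rigid sets -/

/-- `Q` is a multicurve of deficiency `n - 3` on `S_{0,m}` (that is, `(m - 3) - |Q| = n - 3`) and
the image of `f : S_{0,n} → S_{0,m}` is the nontrivial piece of the complement of `Q`. -/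
def IsComplementary {P R : Finset Sphere2}
    (f : PiOneEmbedding (PuncturedSphere P) (PuncturedSphere R))
    (Q : Set (CurveClass (PuncturedSphere R))) : Prop :=
  IsMulticurve Q ∧ Q.encard + P.card = R.card ∧
    ∃ K, IsRealization Q K ∧ Set.range f.toMap = nontrivialPiece K

/-- The embedding `f` induces the map `φ` defined on the vertices of `𝒳`: for some multicurve `Q`
as above, `f(u) ∪ Q = φ(u)` for all vertices `u` of `𝒳`. -/
def Induces {P R : Finset Sphere2} {𝒳 : (pantsGraph P).Subgraph}
    (f : PiOneEmbedding (PuncturedSphere P) (PuncturedSphere R))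
    (φ : 𝒳.verts → PantsDecomposition R) : Prop :=
  ∃ Q, IsComplementary f Q ∧ ∀ u : 𝒳.verts, f.image u.1.1 ∪ Q = (φ u).1

/-- Rigid subgraphs of the pants graph of `S_{0,n}`, for `n ≥ 5`: every injective simplicial map
into the pants graph of a punctured sphere is induced by a `π₁`-injective embedding, whose isotopy
class is unique. -/
def IsRigid {P : Finset Sphere2} (𝒳 : (pantsGraph P).Subgraph) : Prop :=
  ∀ (R : Finset Sphere2) (φ : 𝒳.coe →g pantsGraph R), Function.Injective φ →
    ∃ f : PiOneEmbedding (PuncturedSphere P) (PuncturedSphere R),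
      Induces f φ ∧
      ∀ f' : PiOneEmbedding (PuncturedSphere P) (PuncturedSphere R),
        Induces f' φ → f'.Isotopic f

/-- Weakly rigid subgraphs of the pants graph of `S_{0,n}`, for `n ≥ 5`. -/
def IsWeaklyRigid {P : Finset Sphere2} (𝒳 : (pantsGraph P).Subgraph) : Prop :=
  ∀ (R : Finset Sphere2) (f₁ f₂ : PiOneEmbedding (PuncturedSphere P) (PuncturedSphere R))
    (Q₁ Q₂ : Set (CurveClass (PuncturedSphere R))),
    IsComplementary f₁ Q₁ → IsComplementary f₂ Q₂ →
    (∀ u ∈ 𝒳.verts, f₁.image u.1 ∪ Q₁ = f₂.image u.1 ∪ Q₂) →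
    Q₁ = Q₂ ∧ f₁.Isotopic f₂

end PantsRigidity

end

/-!
# Exhausting the pants graph by finite rigid subgraphs

Let `𝒳 ≤ 𝒵` with `𝒵` rigid, and let `g` be one of the half twists or its inverse. An injective
simplicial map `φ` on a subgraph containing `𝒵` and `g 𝒵` is induced by `(f, Q)` on `𝒵`, and by
some `(f', Q')` on `g 𝒵`, because precomposing with a representative of `g⁻¹` carries inducing
embeddings for `𝒵` to inducing embeddings for `g 𝒵` (`IsRigid.exists_induces_translate`). The two
agree on `𝒵 ⊓ g 𝒵 ≥ 𝒳 ⊓ g 𝒳`, so weak rigidity of the latter gives `Q = Q'` and an isotopy from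
`f` to `f'`. Isotopic embeddings act equally on curve classes, hence `(f, Q)` induces `φ` on
`g 𝒵` as well. As `f` and `Q` come from `𝒵` alone, the same pair works for all half twists
at once; it is unique up to isotopy because it already is on `𝒵` (`IsRigid.sup_iSup_translate`).

The union of the resulting sequence is carried into itself by the half twists and their inverses,
hence by the whole group they generate (`translate_le_of_mem_closure`). It contains `𝒳`, whose
translates cover the pants graph.
-/

namespace PantsRigidity

/-! ### Embeddings precomposed with homeomorphisms -/

section Embeddings

variable {X Y Z : Type} [TopologicalSpace X] [TopologicalSpace Y] [TopologicalSpace Z]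

theorem fundamentalGroup_map_homeomorph_injective (h : X ≃ₜ Y) (x : X) :
    Function.Injective (FundamentalGroup.map (h : C(X, Y)) x) := by
  intro p q hpq
  induction p using Quotient.inductionOn with
  | h γ =>
  induction q using Quotient.inductionOn with
  | h δ =>
  obtain ⟨F⟩ := Quotient.exact hpq
  refine Quotient.sound ⟨{
    toFun := fun t => h.symm (F t)
    map_zero_left := fun t => ?_
    map_one_left := fun t => ?_
    prop' := fun t s hs => ?_ }⟩
  · rw [F.apply_zero]
    exact h.symm_apply_apply _
  · rw [F.apply_one]
    exact h.symm_apply_apply _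
  · exact (congrArg h.symm (F.prop' t s hs)).trans (h.symm_apply_apply _)

/-- Precomposition of a `π₁`-injective embedding with a homeomorphism. -/
def PiOneEmbedding.compHomeomorph (f : PiOneEmbedding Y Z) (h : X ≃ₜ Y) : PiOneEmbedding X Z where
  toMap := f.toMap.comp (h : C(X, Y))
  isEmbedding := f.isEmbedding.comp h.isEmbedding
  piOne_injective x := by
    have key : ∀ p, FundamentalGroup.map (f.toMap.comp (h : C(X, Y))) x p =
        FundamentalGroup.map f.toMap (h x) (FundamentalGroup.map (h : C(X, Y)) x p) := by
      intro p
      induction p using Quotient.inductionOn with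
      | h γ => rfl
    intro p q hpq
    rw [key, key] at hpq
    exact fundamentalGroup_map_homeomorph_injective h x (f.piOne_injective (h x) hpq)

theorem PiOneEmbedding.range_compHomeomorph (f : PiOneEmbedding Y Z) (h : X ≃ₜ Y) :
    Set.range (f.compHomeomorph h).toMap = Set.range f.toMap :=
  h.surjective.range_comp f.toMap

theorem PiOneEmbedding.image_compHomeomorph (f : PiOneEmbedding X Y) (h : X ≃ₜ X)
    (u : Set (CurveClass X)) :
    (f.compHomeomorph h).image u = f.image (modImage (QuotientGroup.mk h : ExtMod X) u) := by
  unfold PiOneEmbedding.image modImage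
  rw [Set.image_image]
  refine Set.image_congr fun α _ => ?_
  induction α using Quotient.inductionOn with
  | h c => rfl

theorem PiOneEmbedding.Isotopic.image_eq {f g : PiOneEmbedding X Y} (h : f.Isotopic g)
    (u : Set (CurveClass X)) : f.image u = g.image u := by
  obtain ⟨H, -, h0, h1⟩ := h
  exact Set.image_congr fun α _ => CurveClass.map_congr_of_homotopic _ _
    ⟨{ toContinuousMap := H, map_zero_left := h0, map_one_left := h1 }⟩ α

end Embeddings

variable {P R : Finset Sphere2}

theorem IsComplementary.compHomeomorph
    {f : PiOneEmbedding (PuncturedSphere P) (PuncturedSphere R)}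
    {Q : Set (CurveClass (PuncturedSphere R))} (hf : IsComplementary f Q)
    (h : PuncturedSphere P ≃ₜ PuncturedSphere P) : IsComplementary (f.compHomeomorph h) Q := by
  refine ⟨hf.1, hf.2.1, ?_⟩
  rw [f.range_compHomeomorph h]
  exact hf.2.2

/-! ### Translates of subgraphs -/

theorem modHom_mul_apply (g h : ExtMod (PuncturedSphere P)) (u : PantsDecomposition P) :
    modHom (g * h) u = modHom g (modHom h u) :=
  Subtype.ext (modImage_mul g h u.1)

theorem modHom_one_apply (u : PantsDecomposition P) : modHom 1 u = u :=
  Subtype.ext (modImage_one u.1)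

theorem modHom_injective (g : ExtMod (PuncturedSphere P)) : Function.Injective (modHom g) := by
  refine Function.LeftInverse.injective (g := modHom g⁻¹) fun u => ?_
  rw [← modHom_mul_apply, inv_mul_cancel, modHom_one_apply]

theorem translate_mono (g : ExtMod (PuncturedSphere P)) {𝒳 𝒵 : (pantsGraph P).Subgraph}
    (h : 𝒳 ≤ 𝒵) : translate g 𝒳 ≤ translate g 𝒵 :=
  SimpleGraph.Subgraph.map_mono h

theorem translate_one (𝒳 : (pantsGraph P).Subgraph) : translate 1 𝒳 = 𝒳 := by
  have : (modHom 1 : pantsGraph P →g pantsGraph P) = SimpleGraph.Hom.id :=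
    RelHom.ext modHom_one_apply
  rw [translate, this, SimpleGraph.Subgraph.map_id]

theorem translate_mul (g h : ExtMod (PuncturedSphere P)) (𝒳 : (pantsGraph P).Subgraph) :
    translate (g * h) 𝒳 = translate g (translate h 𝒳) := by
  have : (modHom (g * h) : pantsGraph P →g pantsGraph P) = (modHom g).comp (modHom h) :=
    RelHom.ext (modHom_mul_apply g h)
  rw [translate, this, SimpleGraph.Subgraph.map_comp]
  rfl

theorem translate_iSup {ι : Sort*} (g : ExtMod (PuncturedSphere P))
    (𝒳 : ι → (pantsGraph P).Subgraph) : translate g (⨆ i, 𝒳 i) = ⨆ i, translate g (𝒳 i) := by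
  have gc : GaloisConnection (SimpleGraph.Subgraph.map (modHom g))
      (SimpleGraph.Subgraph.comap (modHom g)) :=
    SimpleGraph.Subgraph.map_le_iff_le_comap (modHom g)
  exact gc.l_iSup

/-- A subgraph carried into itself by the elements of `S` and their inverses is carried into
itself by the subgroup that `S` generates. -/
theorem translate_le_of_mem_closure {𝒵 : (pantsGraph P).Subgraph}
    {S : Set (ExtMod (PuncturedSphere P))}
    (hS : ∀ g ∈ S, translate g 𝒵 ≤ 𝒵 ∧ translate g⁻¹ 𝒵 ≤ 𝒵)
    {g : ExtMod (PuncturedSphere P)} (hg : g ∈ Subgroup.closure S) : translate g 𝒵 ≤ 𝒵 := by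
  -- The induction passes to inverses only if the claim is made for `g` and `g⁻¹` together.
  have key : translate g 𝒵 ≤ 𝒵 ∧ translate g⁻¹ 𝒵 ≤ 𝒵 := by
    induction hg using Subgroup.closure_induction with
    | mem g hg => exact hS g hg
    | one => simp [translate_one]
    | mul g h _ _ ihg ihh =>
      rw [mul_inv_rev, translate_mul, translate_mul]
      exact ⟨(translate_mono g ihh.1).trans ihg.1, (translate_mono h⁻¹ ihg.2).trans ihh.2⟩
    | inv g _ ih => exact ⟨ih.2, by rw [inv_inv]; exact ih.1⟩
  exact key.1

/-- The simplicial map from a subgraph to its translate. -/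
def translateHom (g : ExtMod (PuncturedSphere P)) (𝒳 : (pantsGraph P).Subgraph) :
    𝒳.coe →g (translate g 𝒳).coe where
  toFun u := ⟨modHom g u.1, u.1, u.2, rfl⟩
  map_rel' {u v} huv := ⟨u.1, v.1, huv, rfl, rfl⟩

theorem translateHom_injective (g : ExtMod (PuncturedSphere P)) (𝒳 : (pantsGraph P).Subgraph) :
    Function.Injective (translateHom g 𝒳) := fun _ _ h =>
  Subtype.ext (modHom_injective g (congrArg Subtype.val h))

/-! ### Gluing rigid subgraphs along weakly rigid ones -/

/-- Every translate of a rigid subgraph has the existence part of rigidity: if `f` induces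
`φ ∘ g` on `𝒳`, then `f ∘ g⁻¹` induces `φ` on `g 𝒳`. -/
theorem IsRigid.exists_induces_translate {𝒳 : (pantsGraph P).Subgraph} (h𝒳 : IsRigid 𝒳)
    (g : ExtMod (PuncturedSphere P)) (φ : (translate g 𝒳).coe →g pantsGraph R)
    (hφ : Function.Injective φ) :
    ∃ f : PiOneEmbedding (PuncturedSphere P) (PuncturedSphere R), Induces f φ := by
  obtain ⟨f, ⟨Q, hQ, hf⟩, -⟩ :=
    h𝒳 R (φ.comp (translateHom g 𝒳)) (hφ.comp (translateHom_injective g 𝒳))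
  obtain ⟨h, rfl⟩ := QuotientGroup.mk_surjective g
  refine ⟨f.compHomeomorph h⁻¹, Q, hQ.compHomeomorph h⁻¹, ?_⟩
  rintro ⟨_, u, hu, rfl⟩
  rw [f.image_compHomeomorph, QuotientGroup.mk_inv]
  change f.image (modImage _ (modImage _ u.1)) ∪ Q = _
  rw [← modImage_mul, inv_mul_cancel, modImage_one]
  exact hf ⟨u, hu⟩

/-- A rigid subgraph stays rigid when translates of it are adjoined whose overlap with it contains
a weakly rigid subgraph. -/
theorem IsRigid.sup_iSup_translate {𝒵 : (pantsGraph P).Subgraph} (h𝒵 : IsRigid 𝒵)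
    {S : Set (ExtMod (PuncturedSphere P))}
    {𝒲 : ExtMod (PuncturedSphere P) → (pantsGraph P).Subgraph}
    (h𝒲 : ∀ g ∈ S, IsWeaklyRigid (𝒲 g)) (hle : ∀ g ∈ S, 𝒲 g ≤ 𝒵 ⊓ translate g 𝒵) :
    IsRigid (𝒵 ⊔ ⨆ g ∈ S, translate g 𝒵) := by
  set 𝒰 := 𝒵 ⊔ ⨆ g ∈ S, translate g 𝒵 with h𝒰
  intro R φ hφ
  have hZ : 𝒵 ≤ 𝒰 := le_sup_left
  have hg : ∀ g ∈ S, translate g 𝒵 ≤ 𝒰 := fun g hg =>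
    (le_iSup₂ (f := fun g _ => translate g 𝒵) g hg).trans le_sup_right
  obtain ⟨f, ⟨Q, hQ, hf⟩, huniq⟩ := h𝒵 R (φ.comp (SimpleGraph.Subgraph.inclusion hZ))
    (hφ.comp (SimpleGraph.Subgraph.inclusion.injective hZ))
  refine ⟨f, ⟨Q, hQ, ?_⟩, ?_⟩
  · rintro ⟨u, hu⟩
    have hu' := hu
    rw [h𝒰] at hu'
    simp only [SimpleGraph.Subgraph.verts_sup, SimpleGraph.Subgraph.verts_iSup,
      Set.mem_union, Set.mem_iUnion] at hu'
    obtain hu' | ⟨g, hgS, hu'⟩ := hu'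
    · exact hf ⟨u, hu'⟩
    · obtain ⟨f', Q', hQ', hf'⟩ := h𝒵.exists_induces_translate g
        (φ.comp (SimpleGraph.Subgraph.inclusion (hg g hgS)))
        (hφ.comp (SimpleGraph.Subgraph.inclusion.injective (hg g hgS)))
      obtain ⟨rfl, hiso⟩ := h𝒲 g hgS R f f' Q Q' hQ hQ' fun v hv =>
        (hf ⟨v, ((hle g hgS).1 hv).1⟩).trans (hf' ⟨v, ((hle g hgS).1 hv).2⟩).symm
      rw [hiso.image_eq]
      exact hf' ⟨u, hu'⟩
  · rintro f' ⟨Q', hQ', hf'⟩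
    exact huniq f' ⟨Q', hQ', fun u => hf' ⟨u.1, hZ.1 u.2⟩⟩

/-! ### The exhaustion -/

/-- The sequence obtained from `𝒳` by repeatedly adjoining the translates by the elements
of `S`. -/
def exhaustion (S : Set (ExtMod (PuncturedSphere P))) (𝒳 : (pantsGraph P).Subgraph) :
    ℕ → (pantsGraph P).Subgraph
  | 0 => 𝒳
  | i + 1 => exhaustion S 𝒳 i ⊔ ⨆ g ∈ S, translate g (exhaustion S 𝒳 i)

variable {S : Set (ExtMod (PuncturedSphere P))} {𝒳 : (pantsGraph P).Subgraph}

theorem exhaustion_monotone : Monotone (exhaustion S 𝒳) :=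
  monotone_nat_of_le_succ fun _ => le_sup_left

theorem exhaustion_finite (hS : S.Finite) (h𝒳 : 𝒳.verts.Finite) (i : ℕ) :
    (exhaustion S 𝒳 i).verts.Finite := by
  induction i with
  | zero => exact h𝒳
  | succ i ih =>
    simp only [exhaustion, SimpleGraph.Subgraph.verts_sup, SimpleGraph.Subgraph.verts_iSup]
    exact ih.union (hS.biUnion fun g _ => ih.image _)

theorem exhaustion_isRigid (h𝒳 : IsRigid 𝒳)
    (hS : ∀ g ∈ S, IsWeaklyRigid (𝒳 ⊓ translate g 𝒳)) (i : ℕ) :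
    IsRigid (exhaustion S 𝒳 i) := by
  induction i with
  | zero => exact h𝒳
  | succ i ih =>
    have h0 : 𝒳 ≤ exhaustion S 𝒳 i := exhaustion_monotone (Nat.zero_le i)
    exact ih.sup_iSup_translate hS fun g _ => inf_le_inf h0 (translate_mono g h0)

theorem translate_iSup_exhaustion_le {g : ExtMod (PuncturedSphere P)} (hg : g ∈ S) :
    translate g (⨆ i, exhaustion S 𝒳 i) ≤ ⨆ i, exhaustion S 𝒳 i := by
  rw [translate_iSup]
  refine iSup_le fun i => le_trans ?_ (le_iSup (exhaustion S 𝒳) (i + 1))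
  exact (le_iSup₂ (f := fun g _ => translate g (exhaustion S 𝒳 i)) g hg).trans le_sup_right

theorem iSup_exhaustion_eq_top (hS : ∀ g ∈ S, g⁻¹ ∈ S)
    (hcover : (⨆ g ∈ Subgroup.closure S, translate g 𝒳) = ⊤) :
    (⨆ i, exhaustion S 𝒳 i) = ⊤ := by
  rw [eq_top_iff, ← hcover]
  refine iSup₂_le fun g hg => ?_
  refine (translate_mono g (le_iSup (exhaustion S 𝒳) 0)).trans ?_
  exact translate_le_of_mem_closure
    (fun h hh => ⟨translate_iSup_exhaustion_le hh, translate_iSup_exhaustion_le (hS h hh)⟩) hg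

end PantsRigidity


theorem mainTheorem2 (n : ℕ) (hn : 5 ≤ n)
    (P : Finset PantsRigidity.Sphere2) (hP : P.card = n)
    (𝒳 : (PantsRigidity.pantsGraph P).Subgraph)
    (hfin : 𝒳.verts.Finite) (hrigid : PantsRigidity.IsRigid 𝒳)
    (hcover : (⨆ g ∈ PantsRigidity.Mod P, PantsRigidity.translate g 𝒳) = ⊤)
    (C : Set (PantsRigidity.CurveClass (PantsRigidity.PuncturedSphere P)))
    (hCfin : C.Finite) (hCess : ∀ α ∈ C, α.IsEssential)
    (T : PantsRigidity.CurveClass (PantsRigidity.PuncturedSphere P) →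
      PantsRigidity.ExtMod (PantsRigidity.PuncturedSphere P))
    (hT : ∀ α ∈ C, PantsRigidity.IsHalfTwist α (T α))
    (hgen : Subgroup.closure (⋃ α ∈ C, {T α, (T α)⁻¹}) = PantsRigidity.Mod P)
    (hweak : ∀ α ∈ C,
      PantsRigidity.IsWeaklyRigid (𝒳 ⊓ PantsRigidity.translate (T α) 𝒳) ∧
      PantsRigidity.IsWeaklyRigid (𝒳 ⊓ PantsRigidity.translate (T α)⁻¹ 𝒳)) :
    ∃ 𝒴 : ℕ → (PantsRigidity.pantsGraph P).Subgraph,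
      𝒴 0 = 𝒳 ∧
      (∀ i, 𝒴 (i + 1) = 𝒴 i ⊔ ⨆ α ∈ C,
        (PantsRigidity.translate (T α) (𝒴 i) ⊔ PantsRigidity.translate (T α)⁻¹ (𝒴 i))) ∧
      Monotone 𝒴 ∧
      (∀ i, (𝒴 i).verts.Finite ∧ PantsRigidity.IsRigid (𝒴 i)) ∧
      (⨆ i, 𝒴 i) = ⊤ := by
  have hmem : ∀ g ∈ ⋃ α ∈ C, {T α, (T α)⁻¹}, ∃ α ∈ C, g = T α ∨ g = (T α)⁻¹ := by
    simp
  open PantsRigidity in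
  refine ⟨exhaustion (⋃ α ∈ C, {T α, (T α)⁻¹}) 𝒳, rfl, fun i => ?_, exhaustion_monotone,
    fun i => ⟨exhaustion_finite (hCfin.biUnion fun α _ => Set.toFinite _) hfin i,
      exhaustion_isRigid hrigid ?_ i⟩, iSup_exhaustion_eq_top ?_ (by rw [hgen]; exact hcover)⟩
  · rw [exhaustion]
    congr 1
    simp only [iSup_iUnion, iSup_insert, iSup_singleton]
  · intro g hg
    obtain ⟨α, hα, rfl | rfl⟩ := hmem g hg
    exacts [(hweak α hα).1, (hweak α hα).2]
  · intro g hg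
    obtain ⟨α, hα, rfl | rfl⟩ := hmem g hg <;>
      exact Set.mem_biUnion hα (by simp)
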